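/- Let $V=[n]$ and let $\widehat{\mathbb S}^n$ be the space of real symmetric matrices with rows and columns indexed by $\{0\}\cup V$, with the trace inner product $\langle X,Y\rangle=\operatorname{tr}(XY^{\top})$; write $X\succeq 0$ for positive semidefinite. Let $\mathcal A:\widehat{\mathbb S}^n\to\mathbb R^m$ and $\mathcal L:\mathbb R^k\to\widehat{\mathbb S}^n$ be linear maps with adjoints $\mathcal A^*,\mathcal L^*$, and let $b\in\mathbb R^m$. For $U\subseteq V$ let $1_U\in\{0,1\}^V$ be its incidence vector. For $\hat C\in\widehat{\mathbb S}^n$ consider the four problems - (ISDP) $\sup\{\langle \hat C,X\rangle : \mathcal A(X)\le b,\ X=\sum_{U\subseteq V}m_U\binom{1}{1_U}\binom{1}{1_U}^{\top}\text{ for some } m:2^V\to\mathbb Z_{+}\}$; - (SDP) $\sup\{\langle \hat C,X\rangle : \mathcal A(X)\le b,\ X\succeq 0\}$; - (SDD) $\inf\{b^{\top}y : y\in\mathbb R^m_{+},\ \mathcal A^*(y)-\hat C\succeq 0\}$; - (ISDD) $\inf\{b^{\top}y : y\in\mathbb Z^m_{+},\ \mathcal A^*(y)-\hat C=\sum_{U\subseteq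 V}m_U\binom{-1}{1_U}\binom{-1}{1_U}^{\top}\text{ for some } m:2^V\to\mathbb Z_{+}\}$. Their values satisfy (ISDP) $\le$ (SDP) $\le$ (SDD) $\le$ (ISDD). The system $\mathcal A(X)\le b$, $X\succeq 0$ is *totally dual integral through $\mathcal L$* if, for every $c\in\mathbb Z^k$, whenever (SDD) with $\hat C=\mathcal L(c)$ has an optimal solution, it has an optimal solution that is feasible in (ISDD). **Theorem.** Suppose that the system $\mathcal A(X)\le b$, $X\succeq 0$ is totally dual integral through $\mathcal L$ and that $b$ is integral. Let $\hat{\mathscr C}=\{X\succeq 0:\mathcal A(X)\le b\}$ and $\mathscr C=\mathcal L^*(\hat{\mathscr C})\subseteq\mathbb R^k$, and suppose that $\hat{\mathscr C}$ contains a positive definite matrix, that $\mathscr C\subseteq[0,1]^k$, and that $\mathscr C$ is compact. Let $\mathscr C_I=\operatorname{conv}(\mathscr C\cap\mathbb Z^k)$, and suppose that $\hat{\mathscr C}$ is a rank-one embedding of $\mathscr C_I$ via $\mathcal L$, that is, for every $\bar x\in\mathscr C\cap\{0,1\}^k$ there is $U\subseteq V$ such that $X=\binom{1}{1_U}\binom{1}{1_U}^{\top}$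 lies in $\hat{\mathscr C}$ and $\mathcal L^*(X)=\bar x$. Then for every $w\in\mathbb Z^k$ the optimal values of (ISDP), (SDP), (SDD) and (ISDD) with $\hat C=\mathcal L(w)$ are all equal to $\max\{w^{\top}x : x\in\mathscr C_I\}$, and all these suprema and infima, including this maximum, are attained. -/

import Mathlib

namespace SemidefTDI

/-- The real vector space of symmetric `W × W` matrices, as a subspace of all matrices. -/
def symSubmodule (W : Type*) : Submodule ℝ (Matrix W W ℝ) where
  carrier := {X | X.IsSymm}
  add_mem' hX hY := hX.add hY
  zero_mem' := Matrix.isSymm_zero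
  smul_mem' c _ hX := hX.smul c

/-- The space of symmetric real `W × W` matrices. It is kept separate from the subtype, so that
the only inner product and norm on it are those of the trace inner product below. -/
def SymMat (W : Type*) : Type _ := symSubmodule W

instance (W : Type*) : AddCommGroup (SymMat W) := inferInstanceAs (AddCommGroup (symSubmodule W))

noncomputable instance (W : Type*) : Module ℝ (SymMat W) :=
  inferInstanceAs (Module ℝ (symSubmodule W))

instance (W : Type*) [Fintype W] : FiniteDimensional ℝ (SymMat W) :=
  inferInstanceAs (FiniteDimensional ℝ (symSubmodule W))

/-- The underlying matrix. -/
def SymMat.toMatrix {W : Type*} : SymMat W →ₗ[ℝ] Matrix W W ℝ := (symSubmodule W).subtype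

/-- The trace inner product `⟨X, Y⟩ = tr (X Yᵀ)`. -/
noncomputable instance SymMat.core (W : Type*) [Fintype W] :
    InnerProductSpace.Core ℝ (SymMat W) where
  inner X Y := (X.toMatrix * Y.toMatrix.transpose).trace
  conj_inner_symm X Y := by
    rw [conj_trivial, ← Matrix.trace_transpose, Matrix.transpose_mul, Matrix.transpose_transpose]
  re_inner_nonneg X := by
    simp only [Matrix.trace, Matrix.diag, Matrix.mul_apply, Matrix.transpose_apply]
    exact Finset.sum_nonneg fun i _ => Finset.sum_nonneg fun j _ => mul_self_nonneg _
  add_left X Y Z := by simp [Matrix.add_mul]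
  smul_left X Y r := by simp
  definite X h := by
    simp only [Matrix.trace, Matrix.diag, Matrix.mul_apply, Matrix.transpose_apply] at h
    apply Subtype.ext
    ext i j
    have h1 := (Finset.sum_eq_zero_iff_of_nonneg
      (fun i _ => Finset.sum_nonneg fun j _ => mul_self_nonneg _)).1 h i (Finset.mem_univ _)
    have h2 := (Finset.sum_eq_zero_iff_of_nonneg
      (fun j _ => mul_self_nonneg _)).1 h1 j (Finset.mem_univ _)
    exact mul_self_eq_zero.1 h2

noncomputable instance (W : Type*) [Fintype W] : NormedAddCommGroup (SymMat W) :=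
  (SymMat.core W).toNormedAddCommGroup

noncomputable instance (W : Type*) [Fintype W] : InnerProductSpace ℝ (SymMat W) :=
  InnerProductSpace.ofCore (SymMat.core W).toCore

/-- The lifted matrix space: symmetric matrices indexed by `{0} ∪ V`. The extra index `0` is
`none`, and `j ∈ V` is `some j`. -/
abbrev SymHat (V : Type*) : Type _ := SymMat (Option V)

/-- The symmetric rank-one matrix `h hᵀ`. -/
def outer {W : Type*} (h : W → ℝ) : SymMat W :=
  ⟨Matrix.vecMulVec h h, by
    ext i j
    simp [Matrix.vecMulVec_apply, mul_comm]⟩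

/-- The vector `t ⊕ 1_U` indexed by `{0} ∪ V`, with `1_U` the incidence vector of `U`. -/
def liftVec {V : Type*} [DecidableEq V] (t : ℝ) (U : Finset V) : Option V → ℝ
  | none => t
  | some j => if j ∈ U then 1 else 0

section

variable {V : Type*} [Fintype V] [DecidableEq V] {m k : ℕ}

/-- The rank-one embedding of a subset `U ⊆ V`: the matrix `(1 ⊕ 1_U)(1 ⊕ 1_U)ᵀ`. -/
def embed (U : Finset V) : SymHat V := outer (liftVec 1 U)

/-- Primal integrality: `X` is a nonnegative integer combination of the matrices
`(1 ⊕ 1_U)(1 ⊕ 1_U)ᵀ`, `U ⊆ V`. -/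
def PrimalIntegral (X : SymHat V) : Prop :=
  ∃ μ : Finset V → ℕ, X = ∑ U : Finset V, (μ U : ℝ) • outer (liftVec 1 U)

/-- Dual integrality: `S` is a nonnegative integer combination of the matrices
`(-1 ⊕ 1_U)(-1 ⊕ 1_U)ᵀ`, `U ⊆ V`. -/
def DualIntegral (S : SymHat V) : Prop :=
  ∃ μ : Finset V → ℕ, S = ∑ U : Finset V, (μ U : ℝ) • outer (liftVec (-1) U)

/-- A real vector with integer coordinates. -/
def IntVec {d : ℕ} (x : EuclideanSpace ℝ (Fin d)) : Prop := ∀ i, ∃ z : ℤ, x i = z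

/-- The feasible region of (SDP): `{X ⪰ 0 : 𝒜(X) ≤ b}`. -/
def sdpFeasible (A : SymHat V →ₗ[ℝ] EuclideanSpace ℝ (Fin m)) (b : EuclideanSpace ℝ (Fin m)) :
    Set (SymHat V) :=
  {X | X.toMatrix.PosSemidef ∧ ∀ i, A X i ≤ b i}

/-- The feasible region of (ISDP). -/
def isdpFeasible (A : SymHat V →ₗ[ℝ] EuclideanSpace ℝ (Fin m)) (b : EuclideanSpace ℝ (Fin m)) :
    Set (SymHat V) :=
  {X | PrimalIntegral X ∧ ∀ i, A X i ≤ b i}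

/-- The feasible region of (SDD): `{y ≥ 0 : 𝒜*(y) - C ⪰ 0}`. -/
noncomputable def sddFeasible (A : SymHat V →ₗ[ℝ] EuclideanSpace ℝ (Fin m)) (C : SymHat V) :
    Set (EuclideanSpace ℝ (Fin m)) :=
  {y | (∀ i, 0 ≤ y i) ∧ (LinearMap.adjoint A y - C).toMatrix.PosSemidef}

/-- The feasible region of (ISDD). -/
noncomputable def isddFeasible (A : SymHat V →ₗ[ℝ] EuclideanSpace ℝ (Fin m)) (C : SymHat V) :
    Set (EuclideanSpace ℝ (Fin m)) :=
  {y | IntVec y ∧ (∀ i, 0 ≤ y i) ∧ DualIntegral (LinearMap.adjoint A y - C)}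

/-- The supremum over `F` of the linear objective `x ↦ ⟨c, x⟩`, in `[-∞, +∞]`. -/
noncomputable def supValue {E : Type*} [NormedAddCommGroup E] [InnerProductSpace ℝ E]
    (c : E) (F : Set E) : EReal :=
  ⨆ x ∈ F, ((inner ℝ c x : ℝ) : EReal)

/-- The infimum over `F` of the linear objective `x ↦ ⟨c, x⟩`, in `[-∞, +∞]`. -/
noncomputable def infValue {E : Type*} [NormedAddCommGroup E] [InnerProductSpace ℝ E]
    (c : E) (F : Set E) : EReal :=
  ⨅ x ∈ F, ((inner ℝ c x : ℝ) : EReal)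

/-- `y` is an optimal solution of the dual problem (SDD). -/
def IsSddOptimal (A : SymHat V →ₗ[ℝ] EuclideanSpace ℝ (Fin m)) (b : EuclideanSpace ℝ (Fin m))
    (C : SymHat V) (y : EuclideanSpace ℝ (Fin m)) : Prop :=
  y ∈ sddFeasible A C ∧ ∀ z ∈ sddFeasible A C, inner ℝ b y ≤ inner ℝ b z

/-- The system `𝒜(X) ≤ b`, `X ⪰ 0` is totally dual integral through `L`: for every integral `c`,
the dual of `sup {⟨L(c), X⟩ : 𝒜(X) ≤ b, X ⪰ 0}` has an integral optimal solution whenever it has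
an optimal solution. -/
def IsTDIThrough (A : SymHat V →ₗ[ℝ] EuclideanSpace ℝ (Fin m)) (b : EuclideanSpace ℝ (Fin m))
    (L : EuclideanSpace ℝ (Fin k) →ₗ[ℝ] SymHat V) : Prop :=
  ∀ c : EuclideanSpace ℝ (Fin k), IntVec c →
    (∃ y, IsSddOptimal A b (L c) y) →
      ∃ y, IsSddOptimal A b (L c) y ∧ y ∈ isddFeasible A (L c)

/-- The integer hull `C_I = conv (C ∩ ℤᵏ)`. -/
def integerHull (C : Set (EuclideanSpace ℝ (Fin k))) : Set (EuclideanSpace ℝ (Fin k)) :=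
  convexHull ℝ (C ∩ {x | IntVec x})

/-- `Chat` is a rank-one embedding of `C_I` via `L` (for `C ⊆ [0,1]ᵏ`): every 0-1 point of `C` is
the image under `L*` of some `(1 ⊕ 1_U)(1 ⊕ 1_U)ᵀ ∈ Chat`. -/
def IsRankOneEmbedding (L : EuclideanSpace ℝ (Fin k) →ₗ[ℝ] SymHat V) (Chat : Set (SymHat V))
    (C : Set (EuclideanSpace ℝ (Fin k))) : Prop :=
  ∀ x ∈ C, (∀ i, x i = 0 ∨ x i = 1) →
    ∃ U : Finset V, embed U ∈ Chat ∧ LinearMap.adjoint L (embed U) = x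

end

end SemidefTDI

open SemidefTDI

/-! The argument is of Edmonds–Giles type. The positive definite feasible point gives strong duality
with dual attainment, so by total dual integrality the maximum of `⟨w, x⟩` over the compact
projection `C`, for integral `w`, equals `⟨b, y⟩` for an integral `y` feasible in (ISDD). As `b` is
integral, this maximum is an integer (`IsTDIThrough.exists_mem_isddFeasible`).

A compact set whose support function is integral at integral vectors passes this property to its
faces in integral directions (`HasIntegralSupport.face`). Cutting the optimal face by all coordinate
directions leaves an integral maximizer. It is a 0-1 point by the box hypothesis, so it lifts to a
rank-one matrix feasible in (ISDP). That matrix and `y` have the same value, which collapses the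
chain of inequalities. -/

/-! ### Farkas' lemma and conic duality -/

/-- **Farkas' lemma** for finitely many linear functionals. -/
theorem exists_nonneg_sum_smul_eq {W : Type*} [AddCommGroup W] [Module ℝ W] {n : ℕ}
    (a : Fin n → W →ₗ[ℝ] ℝ) (c : W →ₗ[ℝ] ℝ)
    (h : ∀ x, (∀ i, a i x ≤ 0) → c x ≤ 0) :
    ∃ y : Fin n → ℝ, (∀ i, 0 ≤ y i) ∧ c = ∑ i, y i • a i := by
  induction n generalizing c with
  | zero =>
    refine ⟨0, fun i => le_rfl, ?_⟩
    ext x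
    have h₁ := h x (fun i => i.elim0)
    have h₂ := h (-x) (fun i => i.elim0)
    rw [map_neg] at h₂
    simp only [Finset.univ_eq_empty, Finset.sum_empty, LinearMap.zero_apply]
    linarith
  | succ n ih =>
    by_cases hc : ∀ x, (∀ i : Fin n, a i.succ x ≤ 0) → c x ≤ 0
    · obtain ⟨y, hy, hcy⟩ := ih (fun i => a i.succ) c hc
      refine ⟨Fin.cons 0 y, fun i => ?_, ?_⟩
      · refine Fin.cases ?_ (fun j => ?_) i
        · simp
        · simpa using hy j
      · simpa [Fin.sum_univ_succ] using hcy
    · push Not at hc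
      obtain ⟨x₁, hx₁, hcx₁⟩ := hc
      have h₀ : 0 < a 0 x₁ := by
        by_contra! h₀
        exact absurd (h x₁ (fun i => Fin.cases h₀ hx₁ i)) (not_le.2 hcx₁)
      set x₂ : W := (a 0 x₁)⁻¹ • x₁ with hx₂
      have h₂₀ : a 0 x₂ = 1 := by simp [hx₂, h₀.ne']
      have h₂ : ∀ i : Fin n, a i.succ x₂ ≤ 0 := fun i => by
        simpa [hx₂] using mul_nonpos_of_nonneg_of_nonpos (inv_nonneg.2 h₀.le) (hx₁ i)
      have hc₂ : 0 < c x₂ := by simpa [hx₂] using mul_pos (inv_pos.2 h₀) hcx₁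
      -- Induction is applied to the functionals composed with the projection `x ↦ x - a 0 x • x₂`
      -- onto the kernel of `a 0`.
      obtain ⟨y, hy, hcy⟩ := ih (fun i => a i.succ - a i.succ x₂ • a 0) (c - c x₂ • a 0) (by
        intro x hx
        have := h (x - a 0 x • x₂) (fun i => by
          refine Fin.cases ?_ (fun j => ?_) i
          · simp [h₂₀]
          · have := hx j
            simp only [LinearMap.sub_apply, LinearMap.smul_apply, smul_eq_mul] at this
            simp only [map_sub, map_smul, smul_eq_mul]
            linarith)
        simp only [map_sub, map_smul, smul_eq_mul] at this
        simp only [LinearMap.sub_apply, LinearMap.smul_apply, smul_eq_mul]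
        linarith)
      refine ⟨Fin.cons (c x₂ - ∑ i, y i * a i.succ x₂) y, fun i => ?_, ?_⟩
      · refine Fin.cases ?_ (fun j => by simpa using hy j) i
        have : ∑ i, y i * a i.succ x₂ ≤ 0 :=
          Finset.sum_nonpos fun i _ => mul_nonpos_of_nonneg_of_nonpos (hy i) (h₂ i)
        simp only [Fin.cons_zero]
        linarith
      · ext x
        have := LinearMap.congr_fun hcy x
        simp only [LinearMap.sub_apply, LinearMap.smul_apply, smul_eq_mul, LinearMap.sum_apply,
          mul_sub, Finset.sum_sub_distrib] at this
        simp only [LinearMap.sum_apply, Fin.sum_univ_succ, Fin.cons_zero, Fin.cons_succ,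
          LinearMap.smul_apply, smul_eq_mul, sub_mul, Finset.sum_mul, LinearMap.add_apply]
        simp only [mul_assoc] at this ⊢
        linarith

/-- The affine form of Farkas' lemma: a linear inequality valid on a nonempty polyhedron is a
nonnegative combination of the defining inequalities, up to slack in the right-hand side. -/
theorem exists_nonneg_sum_smul_eq_of_polyhedron {E : Type*} [AddCommGroup E] [Module ℝ E] {n : ℕ}
    (a : Fin n → E →ₗ[ℝ] ℝ) (b : Fin n → ℝ) (c : E →ₗ[ℝ] ℝ) (d : ℝ)
    (hne : ∃ x, ∀ i, a i x ≤ b i) (h : ∀ x, (∀ i, a i x ≤ b i) → c x ≤ d) :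
    ∃ y : Fin n → ℝ, (∀ i, 0 ≤ y i) ∧ c = ∑ i, y i • a i ∧ ∑ i, y i * b i ≤ d := by
  obtain ⟨x₀, hx₀⟩ := hne
  -- Homogenization: the cone `s ≥ 0`, `a i x ≤ b i * s`. Its slice `s = 0` consists of recession
  -- directions, along which `c` cannot increase from `x₀`.
  obtain ⟨y, hy, hcy⟩ := exists_nonneg_sum_smul_eq (W := E × ℝ)
    (Fin.cons (-LinearMap.snd ℝ E ℝ)
      fun i => (a i) ∘ₗ LinearMap.fst ℝ E ℝ - b i • LinearMap.snd ℝ E ℝ)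
    (c ∘ₗ LinearMap.fst ℝ E ℝ - d • LinearMap.snd ℝ E ℝ) (by
      rintro ⟨x, s⟩ hx
      have hs : 0 ≤ s := by simpa using hx 0
      have hx' : ∀ i, a i x ≤ b i * s := fun i => by simpa using hx i.succ
      suffices c x ≤ d * s by simpa using this
      rcases hs.eq_or_lt with rfl | hs
      · simp only [mul_zero] at hx' ⊢
        by_contra! hcx
        have := h (x₀ + ((d - c x₀ + 1) / c x) • x) (fun i => by
          have h₁ : 0 ≤ (d - c x₀ + 1) / c x :=
            div_nonneg (by linarith [h x₀ hx₀]) hcx.le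
          have h₂ := mul_nonpos_of_nonneg_of_nonpos h₁ (hx' i)
          simp only [map_add, map_smul, smul_eq_mul]
          linarith [hx₀ i])
        simp only [map_add, map_smul, smul_eq_mul, div_mul_cancel₀ _ hcx.ne'] at this
        linarith
      · have := h (s⁻¹ • x) (fun i => by
          rw [map_smul, smul_eq_mul, inv_mul_le_iff₀ hs, mul_comm]
          exact hx' i)
        rw [map_smul, smul_eq_mul, inv_mul_le_iff₀ hs, mul_comm] at this
        exact this)
  refine ⟨fun i => y i.succ, fun i => hy _, ?_, ?_⟩
  · ext x
    have := LinearMap.congr_fun hcy (x, 0)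
    simpa [Fin.sum_univ_succ] using this
  · have := LinearMap.congr_fun hcy (0, 1)
    simp only [Fin.sum_univ_succ] at this
    simp at this
    linarith [hy 0]

/-- Strong duality for the maximization of `c` over the part of an open convex cone `K` cut out by
finitely many linear inequalities, with attainment in the dual problem. -/
theorem exists_dual_of_isOpen_cone {E : Type*} [NormedAddCommGroup E] [NormedSpace ℝ E] {m : ℕ}
    {K : Set E} (hK : IsOpen K) (hconv : Convex ℝ K)
    (hcone : ∀ x ∈ K, ∀ t : ℝ, 0 < t → t • x ∈ K)
    (a : Fin m → E →ₗ[ℝ] ℝ) (b : Fin m → ℝ) (c : E →ₗ[ℝ] ℝ) (v : ℝ)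
    {x₀ : E} (hx₀ : x₀ ∈ K) (hx₀b : ∀ i, a i x₀ ≤ b i)
    (h : ∀ x ∈ K, (∀ i, a i x ≤ b i) → c x ≤ v) :
    ∃ y : Fin m → ℝ, (∀ i, 0 ≤ y i) ∧ (∀ x ∈ K, c x ≤ ∑ i, y i * a i x) ∧
      ∑ i, y i * b i ≤ v := by
  by_cases hQ : ∃ z, (∀ i, a i z ≤ b i) ∧ v < c z
  swap
  · push Not at hQ
    obtain ⟨y, hy, hcy, hyv⟩ := exists_nonneg_sum_smul_eq_of_polyhedron a b c v ⟨x₀, hx₀b⟩ hQ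
    exact ⟨y, hy, fun x _ => by simp [hcy], hyv⟩
  obtain ⟨z, hz, hzv⟩ := hQ
  have hQconv : Convex ℝ {z | (∀ i, a i z ≤ b i) ∧ v < c z} := by
    rw [Set.ofPred_and, Set.ofPred_forall]
    exact (convex_iInter fun i => convex_halfSpace_le (a i).isLinear _).inter
      (convex_halfSpace_gt c.isLinear _)
  obtain ⟨f, α, hfK, hfQ⟩ := geometric_hahn_banach_open hconv hK hQconv
    (Set.disjoint_left.2 fun x hxK hx => absurd (h x hxK hx.1) (not_le.2 hx.2))
  have hf : ∀ x ∈ K, f x ≤ 0 := by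
    intro x hx
    by_contra! hpos
    have := hfK _ (hcone x hx ((|α| + 1) / f x) (by positivity))
    rw [map_smul, smul_eq_mul, div_mul_cancel₀ _ hpos.ne'] at this
    linarith [le_abs_self α]
  have hα : 0 ≤ α := by
    by_contra! hneg
    have h₁ := hfK _ hx₀
    have hpos : 0 < α / (2 * f x₀) := div_pos_of_neg_of_neg hneg (by linarith)
    have := hfK _ (hcone x₀ hx₀ _ hpos)
    have h₂ : α / (2 * f x₀) * f x₀ = α / 2 := by
      have : f x₀ ≠ 0 := by linarith
      field_simp
    rw [map_smul, smul_eq_mul, h₂] at this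
    linarith
  -- Openness of `K` gives strictness at `x₀`; this later forces the multiplier of `c` to be
  -- positive.
  have hf₀ : f x₀ < 0 := by
    rcases hα.eq_or_lt with rfl | hα
    · exact hfK _ hx₀
    have hfz : 0 < f z := hα.trans_le (hfQ z ⟨hz, hzv⟩)
    have hcont : Continuous fun t : ℝ => x₀ + t • z := by fun_prop
    have hnhds : ∀ᶠ t in nhds (0 : ℝ), x₀ + t • z ∈ K :=
      hcont.continuousAt.eventually (hK.mem_nhds (by simpa using hx₀))
    obtain ⟨ε, hε, hball⟩ := Metric.eventually_nhds_iff.1 hnhds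
    have := hf _ (hball (y := ε / 2) (by
      rw [Real.dist_eq, sub_zero, abs_of_pos (by positivity)]
      linarith))
    rw [map_add, map_smul, smul_eq_mul] at this
    have : 0 < ε / 2 * f z := by positivity
    linarith
  have hfQ' : ∀ x, (∀ i, a i x ≤ b i) → v ≤ c x → 0 ≤ f x := by
    intro x hx hxv
    by_contra! hneg
    have hz0 : 0 ≤ f z := hα.trans (hfQ z ⟨hz, hzv⟩)
    -- With this `t`, `f` takes the negative value `f x / 2` on the segment from `x` to `z`, at a
    -- point with `c > v`.
    set t : ℝ := (-f x / 2) / (f z - f x) with ht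
    have hd : 0 < f z - f x := by linarith
    have ht0 : 0 < t := div_pos (by linarith) hd
    have ht1 : t ≤ 1 := by rw [ht, div_le_one hd]; linarith
    have hmem := hfQ ((1 - t) • x + t • z) ⟨fun i => by
      simp only [map_add, map_smul, smul_eq_mul]
      nlinarith [hx i, hz i, mul_le_mul_of_nonneg_left (hx i) (sub_nonneg.2 ht1),
        mul_le_mul_of_nonneg_left (hz i) ht0.le], by
      simp only [map_add, map_smul, smul_eq_mul]
      nlinarith [mul_le_mul_of_nonneg_left hxv (sub_nonneg.2 ht1),
        mul_lt_mul_of_pos_left hzv ht0]⟩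
    simp only [map_add, map_smul, smul_eq_mul] at hmem
    have : t * (f z - f x) = -f x / 2 := div_mul_cancel₀ _ hd.ne'
    linarith
  obtain ⟨y, hy, hfy, hyb⟩ := exists_nonneg_sum_smul_eq_of_polyhedron
    (Fin.cons (-c) a) (Fin.cons (-v) b) (-(f : E →ₗ[ℝ] ℝ)) 0
    ⟨z, fun i => Fin.cases (by simpa using hzv.le) (fun j => by simpa using hz j) i⟩
    (fun x hx => by
      have := hfQ' x (fun i => by simpa using hx i.succ) (by simpa using hx 0)
      simpa using this)
  have hfy' : ∀ x, -f x = -(y 0 * c x) + ∑ i : Fin m, y i.succ * a i x := fun x => by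
    simpa [Fin.sum_univ_succ] using LinearMap.congr_fun hfy x
  simp only [Fin.sum_univ_succ, Fin.cons_zero, Fin.cons_succ] at hyb
  -- If `y 0 = 0`, feasibility of `x₀` would give `-f x₀ ≤ 0`.
  have hy0 : 0 < y 0 := by
    refine (hy 0).lt_of_ne fun hy0 => ?_
    have h₁ := hfy' x₀
    have h₂ : ∑ i : Fin m, y i.succ * a i x₀ ≤ ∑ i : Fin m, y i.succ * b i :=
      Finset.sum_le_sum fun i _ => mul_le_mul_of_nonneg_left (hx₀b i) (hy _)
    rw [← hy0] at hyb h₁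
    linarith
  refine ⟨fun i => y i.succ / y 0, fun i => div_nonneg (hy _) hy0.le, fun x hx => ?_, ?_⟩
  · have h₁ := hfy' x
    have h₂ := hf x hx
    simp only [div_mul_eq_mul_div, ← Finset.sum_div]
    rw [le_div_iff₀ hy0]
    linarith
  · simp only [div_mul_eq_mul_div, ← Finset.sum_div]
    rw [div_le_iff₀ hy0]
    linarith

namespace SemidefTDI

/-! ### Compact sets with integral support function -/

section IntegralSupport

variable {k : ℕ}

theorem IntVec.nsmul_add {d : ℕ} {w u : EuclideanSpace ℝ (Fin d)} (hw : IntVec w) (hu : IntVec u)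
    (N : ℕ) : IntVec ((N : ℝ) • w + u) := fun i => by
  obtain ⟨p, hp⟩ := hw i
  obtain ⟨q, hq⟩ := hu i
  exact ⟨N * p + q, by simp [hp, hq]⟩

theorem IntVec.single {d : ℕ} (i : Fin d) : IntVec (EuclideanSpace.single i (1 : ℝ)) := fun j => by
  by_cases h : j = i
  · exact ⟨1, by simp [h]⟩
  · exact ⟨0, by simp [h]⟩

theorem IntVec.exists_inner_eq {d : ℕ} {x y : EuclideanSpace ℝ (Fin d)} (hx : IntVec x)
    (hy : IntVec y) : ∃ z : ℤ, inner ℝ x y = (z : ℝ) := by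
  choose p hp using hx
  choose q hq using hy
  exact ⟨∑ i, q i * p i, by simp [PiLp.inner_apply, hp, hq]⟩

/-- The support function of `S` takes integer values, attained on `S`, at integer vectors. -/
def HasIntegralSupport (S : Set (EuclideanSpace ℝ (Fin k))) : Prop :=
  ∀ u, IntVec u → ∃ z : ℤ, IsGreatest ((fun x => inner ℝ u x) '' S) (z : ℝ)

/-- An exposed face, in an integral direction, of a compact set with integral support function
has integral support function. -/
theorem HasIntegralSupport.face {S : Set (EuclideanSpace ℝ (Fin k))} (hS : HasIntegralSupport S)
    (hcpt : IsCompact S) {w : EuclideanSpace ℝ (Fin k)} (hw : IntVec w) {h : ℝ}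
    (hh : IsGreatest ((fun x => inner ℝ w x) '' S) h) :
    HasIntegralSupport {x ∈ S | inner ℝ w x = h} := by
  intro u hu
  have hcont : ∀ p : EuclideanSpace ℝ (Fin k), Continuous fun x : EuclideanSpace ℝ (Fin k) =>
      (inner ℝ p x : ℝ) := fun p => by fun_prop
  have hF : IsCompact {x ∈ S | inner ℝ w x = h} :=
    hcpt.inter_right (isClosed_eq (hcont w) continuous_const)
  have hFne : {x ∈ S | inner ℝ w x = h}.Nonempty := by
    obtain ⟨x, hx, hxh⟩ := hh.1
    exact ⟨x, hx, hxh⟩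
  obtain ⟨x₁, hx₁, hmax⟩ := hF.exists_isMaxOn hFne (hcont u).continuousOn
  have hM : IsGreatest ((fun x => inner ℝ u x) '' {x ∈ S | inner ℝ w x = h}) (inner ℝ u x₁) :=
    ⟨⟨x₁, hx₁, rfl⟩, by rintro _ ⟨x, hx, rfl⟩; exact hmax hx⟩
  set M : ℝ := inner ℝ u x₁ with hMdef
  suffices hceil : (⌈M⌉ : ℝ) ≤ M by
    refine ⟨⌈M⌉, ?_⟩
    rwa [le_antisymm hceil (Int.le_ceil M)]
  by_contra! hlt
  obtain ⟨B, hB⟩ := hS u hu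
  -- Maximize `N • w + u`: the maximum is an integer at least `N * h + M`, so it can be rounded up
  -- to `N * h + ⌈M⌉`.
  have key : ∀ N : ℕ, ∃ x ∈ S, (⌈M⌉ : ℝ) ≤ inner ℝ u x ∧
      N * (h - inner ℝ w x) ≤ B - ⌈M⌉ := by
    intro N
    obtain ⟨z, ⟨x, hx, hxz⟩, hz⟩ := hS _ (hw.nsmul_add hu N)
    obtain ⟨h', hh'⟩ := hS w hw
    obtain rfl := hh'.unique hh
    simp only [inner_add_left, real_inner_smul_left] at hxz
    have h₁ : N * (h' : ℝ) + M ≤ z := by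
      have := hz ⟨x₁, hx₁.1, rfl⟩
      simpa [inner_add_left, real_inner_smul_left, hx₁.2] using this
    have h₂ : ⌈M⌉ ≤ z - N * h' := Int.ceil_le.2 (by push_cast; linarith)
    have h₂' : (⌈M⌉ : ℝ) ≤ z - N * h' := by exact_mod_cast h₂
    have h₃ : inner ℝ w x ≤ (h' : ℝ) := hh.2 ⟨x, hx, rfl⟩
    have h₄ : inner ℝ u x ≤ (B : ℝ) := hB.2 ⟨x, hx, rfl⟩
    have h₅ := mul_le_mul_of_nonneg_left h₃ (Nat.cast_nonneg (α := ℝ) N)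
    exact ⟨x, hx, by linarith, by linarith⟩
  -- If `M < ⌈M⌉`, this compact set misses the face, so `h - ⟨w, x⟩` is bounded away from `0` on it;
  -- a large `N` contradicts `key`.
  have hT : IsCompact (S ∩ {x | (⌈M⌉ : ℝ) ≤ inner ℝ u x}) :=
    hcpt.inter_right (isClosed_le continuous_const (hcont u))
  obtain ⟨x₂, hx₂, hx₂u, -⟩ := key 0
  obtain ⟨p, hp, hpmax⟩ := hT.exists_isMaxOn ⟨x₂, hx₂, hx₂u⟩ (hcont w).continuousOn
  have hph : inner ℝ w p < h := by
    refine (hh.2 ⟨p, hp.1, rfl⟩ : inner ℝ w p ≤ h).lt_of_ne fun heq => ?_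
    have h₁ : inner ℝ u p ≤ M := hM.2 ⟨p, ⟨hp.1, heq⟩, rfl⟩
    have h₂ : (⌈M⌉ : ℝ) ≤ inner ℝ u p := hp.2
    linarith
  obtain ⟨N, hN⟩ := exists_nat_gt ((B - ⌈M⌉) / (h - inner ℝ w p))
  rw [div_lt_iff₀ (by linarith)] at hN
  obtain ⟨x, hx, hxu, hxw⟩ := key N
  have h₁ : inner ℝ w x ≤ inner ℝ w p := hpmax ⟨hx, hxu⟩
  have h₂ := mul_le_mul_of_nonneg_left h₁ (Nat.cast_nonneg (α := ℝ) N)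
  linarith

/-- A compact set with integral support function has, in every integral direction, an integral
maximizer. -/
theorem HasIntegralSupport.exists_intVec_isMaxOn {S : Set (EuclideanSpace ℝ (Fin k))}
    (hS : HasIntegralSupport S) (hcpt : IsCompact S) {w : EuclideanSpace ℝ (Fin k)}
    (hw : IntVec w) : ∃ x ∈ S, IntVec x ∧ ∀ y ∈ S, inner ℝ w y ≤ inner ℝ w x := by
  have hface : ∀ T : Set (EuclideanSpace ℝ (Fin k)), HasIntegralSupport T → IsCompact T →
      ∀ u, IntVec u → ∃ z : ℤ, IsGreatest ((fun x => inner ℝ u x) '' T) (z : ℝ) ∧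
        ∃ F ⊆ T, HasIntegralSupport F ∧ IsCompact F ∧ ∀ x ∈ F, inner ℝ u x = (z : ℝ) := by
    intro T hT hTc u hu
    obtain ⟨z, hz⟩ := hT u hu
    refine ⟨z, hz, {x ∈ T | inner ℝ u x = (z : ℝ)}, Set.sep_subset _ _, hT.face hTc hu hz, ?_,
      fun x hx => hx.2⟩
    exact hTc.inter_right (isClosed_eq (by fun_prop) continuous_const)
  obtain ⟨h, hh, F₀, hF₀S, hF₀, hF₀c, hF₀w⟩ := hface S hS hcpt w hw
  have hcoord : ∀ s : Finset (Fin k), ∃ F ⊆ F₀, HasIntegralSupport F ∧ IsCompact F ∧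
      ∀ i ∈ s, ∃ z : ℤ, ∀ x ∈ F, x i = z := by
    intro s
    induction s using Finset.induction_on with
    | empty => exact ⟨F₀, subset_rfl, hF₀, hF₀c, by simp⟩
    | insert i s _ ih =>
      obtain ⟨F, hFF₀, hF, hFc, hFs⟩ := ih
      obtain ⟨z, -, G, hGF, hG, hGc, hGz⟩ := hface F hF hFc _ (IntVec.single i)
      refine ⟨G, hGF.trans hFF₀, hG, hGc, fun j hj => ?_⟩
      rcases Finset.mem_insert.1 hj with rfl | hj
      · exact ⟨z, fun x hx => by simpa [EuclideanSpace.inner_single_left] using hGz x hx⟩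
      · obtain ⟨z', hz'⟩ := hFs j hj
        exact ⟨z', fun x hx => hz' x (hGF hx)⟩
  obtain ⟨F, hFF₀, hF, -, hFint⟩ := hcoord Finset.univ
  -- Integral support includes attainment, so the final face is nonempty.
  obtain ⟨-, ⟨x, hx, -⟩, -⟩ := hF w hw
  refine ⟨x, hF₀S (hFF₀ hx), fun i => ?_, fun y hy => ?_⟩
  · obtain ⟨z, hz⟩ := hFint i (Finset.mem_univ i)
    exact ⟨z, hz x hx⟩
  · rw [hF₀w x (hFF₀ hx)]
    exact hh.2 ⟨y, hy, rfl⟩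

end IntegralSupport

/-! ### The semidefinite cone under the trace inner product -/

section Semidefinite

variable {W : Type*}

theorem SymMat.isHermitian (X : SymMat W) : X.toMatrix.IsHermitian := by
  have h : X.toMatrix.transpose = X.toMatrix := X.2
  rwa [Matrix.IsHermitian, Matrix.conjTranspose_eq_transpose_of_trivial]

theorem SymMat.toMatrix_outer (u : W → ℝ) : (outer u).toMatrix = Matrix.vecMulVec u u := rfl

theorem outer_smul (t : ℝ) (u : W → ℝ) : outer (t • u) = t ^ 2 • outer u := by
  apply Subtype.ext
  change Matrix.vecMulVec (t • u) (t • u) = t ^ 2 • Matrix.vecMulVec u u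
  ext i j
  simp [Matrix.vecMulVec_apply]
  ring

variable [Fintype W]

theorem SymMat.inner_def (X Y : SymMat W) :
    inner ℝ X Y = (X.toMatrix * Y.toMatrix.transpose).trace := rfl

theorem SymMat.inner_outer (X : SymMat W) (u : W → ℝ) :
    inner ℝ X (outer u) = u ⬝ᵥ (X.toMatrix.mulVec u) := by
  rw [SymMat.inner_def, SymMat.toMatrix_outer, Matrix.transpose_vecMulVec,
    Matrix.mul_vecMulVec, Matrix.trace_vecMulVec, dotProduct_comm]

theorem SymMat.posSemidef_iff (X : SymMat W) :
    X.toMatrix.PosSemidef ↔ ∀ u : W → ℝ, 0 ≤ inner ℝ X (outer u) := by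
  rw [Matrix.posSemidef_iff_dotProduct_mulVec, and_iff_right X.isHermitian]
  simp [SymMat.inner_outer]

theorem SymMat.posDef_iff (X : SymMat W) :
    X.toMatrix.PosDef ↔ ∀ u : W → ℝ, u ≠ 0 → 0 < inner ℝ X (outer u) := by
  rw [Matrix.posDef_iff_dotProduct_mulVec, and_iff_right X.isHermitian]
  simp [SymMat.inner_outer]

theorem posSemidef_outer (u : W → ℝ) : (outer u).toMatrix.PosSemidef := by
  simpa [SymMat.toMatrix_outer] using Matrix.posSemidef_vecMulVec_self_star u

/-- The cone of positive semidefinite matrices is contained in its dual. -/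
theorem SymMat.inner_nonneg {X Y : SymMat W} (hX : X.toMatrix.PosSemidef)
    (hY : Y.toMatrix.PosSemidef) : 0 ≤ inner ℝ X Y := by
  obtain ⟨m, a, ha⟩ := Matrix.posSemidef_iff_eq_sum_vecMulVec.1 hY
  have hsum : Y = ∑ i, outer (a i) := by
    apply Subtype.ext
    change SymMat.toMatrix Y = SymMat.toMatrix (∑ i, outer (a i))
    rw [ha, map_sum]
    simp [SymMat.toMatrix_outer]
  rw [hsum, inner_sum]
  exact Finset.sum_nonneg fun i _ => (SymMat.posSemidef_iff X).1 hX _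

/-- Positivity of the quadratic form on the compact unit sphere survives small perturbations by the
tube lemma; homogeneity extends it to all nonzero vectors. -/
theorem SymMat.isOpen_posDef : IsOpen {X : SymMat W | X.toMatrix.PosDef} := by
  rw [isOpen_iff_mem_nhds]
  intro X hX
  have hcont : Continuous fun p : SymMat W × (W → ℝ) =>
      p.2 ⬝ᵥ (p.1.toMatrix.mulVec p.2) := by
    have : Continuous (SymMat.toMatrix (W := W)) := LinearMap.continuous_of_finiteDimensional _
    fun_prop
  obtain ⟨O, T, hO, -, hXO, hT, hOT⟩ := generalized_tube_lemma (isCompact_singleton (x := X))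
    (isCompact_sphere (0 : W → ℝ) 1) (isOpen_lt continuous_const hcont) (by
      rintro ⟨Y, u⟩ ⟨hY, hu⟩
      obtain rfl : Y = X := hY
      have hu0 : u ≠ 0 := by
        rintro rfl
        simp at hu
      have := (SymMat.posDef_iff Y).1 hX u hu0
      rwa [SymMat.inner_outer] at this)
  refine Filter.mem_of_superset (hO.mem_nhds (hXO rfl)) fun Y hY => ?_
  rw [Set.mem_ofPred_eq, SymMat.posDef_iff]
  intro u hu
  have hn : 0 < ‖u‖ := norm_pos_iff.2 hu
  have hmem : ‖u‖⁻¹ • u ∈ Metric.sphere (0 : W → ℝ) 1 := by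
    simp [norm_smul, hn.ne']
  have hpos : 0 < (‖u‖⁻¹ • u) ⬝ᵥ (Y.toMatrix.mulVec (‖u‖⁻¹ • u)) :=
    hOT (Set.mk_mem_prod hY (hT hmem))
  rw [← SymMat.inner_outer, outer_smul, real_inner_smul_right] at hpos
  exact pos_of_mul_pos_right hpos (by positivity)

end Semidefinite

/-! ### Weak and strong semidefinite duality -/

section Duality

variable {V : Type*} [Fintype V] {m : ℕ}
  {A : SymHat V →ₗ[ℝ] EuclideanSpace ℝ (Fin m)} {b : EuclideanSpace ℝ (Fin m)} {C : SymHat V}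

theorem inner_le_inner_of_feasible {X : SymHat V} (hX : X ∈ sdpFeasible A b)
    {y : EuclideanSpace ℝ (Fin m)} (hy : y ∈ sddFeasible A C) :
    inner ℝ C X ≤ inner ℝ b y := by
  have h₁ := SymMat.inner_nonneg hy.2 hX.1
  rw [inner_sub_left, LinearMap.adjoint_inner_left] at h₁
  have h₂ : inner ℝ y (A X) ≤ inner ℝ b y := by
    simp only [PiLp.inner_apply, RCLike.inner_apply, conj_trivial]
    refine Finset.sum_le_sum fun i _ => ?_
    rw [mul_comm (y i)]
    exact mul_le_mul_of_nonneg_right (hX.2 i) (hy.1 i)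
  linarith

theorem isdpFeasible_subset [DecidableEq V] : isdpFeasible A b ⊆ sdpFeasible A b := by
  rintro X ⟨⟨μ, rfl⟩, hX⟩
  refine ⟨?_, hX⟩
  rw [map_sum]
  refine Matrix.posSemidef_sum _ fun U _ => ?_
  rw [map_smul]
  exact (posSemidef_outer _).smul (Nat.cast_nonneg _)

theorem isddFeasible_subset [DecidableEq V] : isddFeasible A C ⊆ sddFeasible A C := by
  rintro y ⟨-, hy, μ, hμ⟩
  refine ⟨hy, ?_⟩
  rw [hμ, map_sum]
  refine Matrix.posSemidef_sum _ fun U _ => ?_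
  rw [map_smul]
  exact (posSemidef_outer _).smul (Nat.cast_nonneg _)

/-- Semidefinite strong duality: if a positive definite matrix is feasible, then every upper bound
on the primal problem is certified by a dual feasible solution. -/
theorem exists_mem_sddFeasible_inner_le {v : ℝ}
    (hpd : ∃ X ∈ sdpFeasible A b, X.toMatrix.PosDef)
    (hv : ∀ X ∈ sdpFeasible A b, inner ℝ C X ≤ v) :
    ∃ y ∈ sddFeasible A C, inner ℝ b y ≤ v := by
  obtain ⟨X₀, hX₀, hX₀pd⟩ := hpd
  have hcone : ∀ X ∈ {X : SymHat V | X.toMatrix.PosDef}, ∀ t : ℝ, 0 < t →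
      t • X ∈ {X : SymHat V | X.toMatrix.PosDef} := by
    intro X hX t ht
    rw [Set.mem_ofPred_eq, map_smul]
    exact Matrix.PosDef.smul hX ht
  have hconv : Convex ℝ {X : SymHat V | X.toMatrix.PosDef} := by
    rw [convex_iff_forall_pos]
    intro X hX Y hY s t hs ht _
    have h₁ := hcone X hX s hs
    have h₂ := hcone Y hY t ht
    rw [Set.mem_ofPred_eq] at h₁ h₂ ⊢
    rw [map_add]
    exact h₁.add h₂
  obtain ⟨y, hy, hyC, hyb⟩ := exists_dual_of_isOpen_cone SymMat.isOpen_posDef hconv hcone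
    (fun i => (EuclideanSpace.proj i : EuclideanSpace ℝ (Fin m) →L[ℝ] ℝ).toLinearMap ∘ₗ A)
    (fun i => b i) (innerₗ (SymHat V) C) v hX₀pd (fun i => by simpa using hX₀.2 i)
    (fun X hX hXb => by
      have := hv X ⟨Matrix.PosDef.posSemidef hX, fun i => by simpa using hXb i⟩
      simpa using this)
  refine ⟨WithLp.toLp 2 y, ⟨fun i => hy i, ?_⟩, ?_⟩
  · set S := LinearMap.adjoint A (WithLp.toLp 2 y) - C with hS
    have hSK : ∀ X : SymHat V, X.toMatrix.PosDef → 0 ≤ inner ℝ S X := by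
      intro X hX
      have := hyC X hX
      rw [hS, inner_sub_left, LinearMap.adjoint_inner_left]
      simp only [PiLp.inner_apply, RCLike.inner_apply, conj_trivial]
      simp only [mul_comm ((A X) _)]
      simpa using this
    rw [SymMat.posSemidef_iff]
    intro u
    refine le_of_forall_pos_le_add fun ε hε => ?_
    -- The certificate covers only positive definite matrices, so `outer u` is perturbed by `t • X₀`
    -- at a cost of at most `ε`; the `+ 1` keeps the denominator positive.
    set t : ℝ := ε / (inner ℝ S X₀ + 1) with ht
    have h₀ : 0 ≤ inner ℝ S X₀ := hSK X₀ hX₀pd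
    have ht0 : 0 < t := by positivity
    have h₁ := hSK (outer u + t • X₀) (by
      rw [map_add, map_smul]
      exact Matrix.PosDef.posSemidef_add (posSemidef_outer u) (Matrix.PosDef.smul hX₀pd ht0))
    rw [inner_add_right, real_inner_smul_right] at h₁
    have h₂ : t * (inner ℝ S X₀ + 1) = ε := div_mul_cancel₀ _ (by positivity)
    linarith
  · simpa [PiLp.inner_apply] using hyb

end Duality

/-! ### Optimal values and the main theorem -/

theorem supValue_eq {E : Type*} [NormedAddCommGroup E] [InnerProductSpace ℝ E] {c : E} {F : Set E}
    {v : ℝ} (hle : ∀ x ∈ F, inner ℝ c x ≤ v) (hex : ∃ x ∈ F, inner ℝ c x = v) :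
    supValue c F = v := by
  obtain ⟨x, hx, hxv⟩ := hex
  refine le_antisymm (iSup₂_le fun y hy => EReal.coe_le_coe_iff.2 (hle y hy)) ?_
  rw [← hxv]
  exact le_iSup₂ (f := fun x (_ : x ∈ F) => ((inner ℝ c x : ℝ) : EReal)) x hx

theorem infValue_eq {E : Type*} [NormedAddCommGroup E] [InnerProductSpace ℝ E] {c : E} {F : Set E}
    {v : ℝ} (hle : ∀ x ∈ F, v ≤ inner ℝ c x) (hex : ∃ x ∈ F, inner ℝ c x = v) :
    infValue c F = v := by
  obtain ⟨x, hx, hxv⟩ := hex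
  refine le_antisymm ?_ (le_iInf₂ fun y hy => EReal.coe_le_coe_iff.2 (hle y hy))
  rw [← hxv]
  exact iInf₂_le (f := fun x (_ : x ∈ F) => ((inner ℝ c x : ℝ) : EReal)) x hx

theorem primalIntegral_embed {V : Type*} [Fintype V] [DecidableEq V] (U : Finset V) :
    PrimalIntegral (embed U) :=
  ⟨fun T => if T = U then 1 else 0, by simp [embed]⟩

/-- Total dual integrality makes the integral dual problem attain the maximum of the primal
problem projected along `L`. -/
theorem IsTDIThrough.exists_mem_isddFeasible {V : Type*} [Fintype V] [DecidableEq V] {m k : ℕ}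
    {A : SymHat V →ₗ[ℝ] EuclideanSpace ℝ (Fin m)} {b : EuclideanSpace ℝ (Fin m)}
    {L : EuclideanSpace ℝ (Fin k) →ₗ[ℝ] SymHat V} (hTDI : IsTDIThrough A b L)
    (hpd : ∃ X ∈ sdpFeasible A b, X.toMatrix.PosDef)
    (hcpt : IsCompact (LinearMap.adjoint L '' sdpFeasible A b))
    {w : EuclideanSpace ℝ (Fin k)} (hw : IntVec w) :
    ∃ y ∈ isddFeasible A (L w), IsGreatest
      ((fun x => inner ℝ w x) '' (LinearMap.adjoint L '' sdpFeasible A b)) (inner ℝ b y) := by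
  obtain ⟨X₀, hX₀, hX₀pd⟩ := hpd
  obtain ⟨_, ⟨X, hX, rfl⟩, hmax⟩ := hcpt.exists_isMaxOn ⟨_, X₀, hX₀, rfl⟩
    (f := fun x => inner ℝ w x) (by fun_prop)
  have hmax' : ∀ Y ∈ sdpFeasible A b, inner ℝ (L w) Y ≤ inner ℝ (L w) X := fun Y hY => by
    rw [← LinearMap.adjoint_inner_right, ← LinearMap.adjoint_inner_right]
    exact hmax ⟨Y, hY, rfl⟩
  obtain ⟨y, hy, hyX⟩ := exists_mem_sddFeasible_inner_le ⟨X₀, hX₀, hX₀pd⟩ hmax'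
  obtain ⟨z, hzopt, hz⟩ := hTDI w hw
    ⟨y, hy, fun z hz => hyX.trans (inner_le_inner_of_feasible hX hz)⟩
  have hzX : inner ℝ b z = inner ℝ w (LinearMap.adjoint L X) := by
    rw [LinearMap.adjoint_inner_right]
    exact le_antisymm ((hzopt.2 y hy).trans hyX) (inner_le_inner_of_feasible hX hzopt.1)
  refine ⟨z, hz, ⟨_, ⟨X, hX, rfl⟩, hzX.symm⟩, ?_⟩
  rintro _ ⟨x, hx, rfl⟩
  rw [hzX]
  exact hmax hx

end SemidefTDI

theorem theorem14 {V : Type*} [Fintype V] [DecidableEq V] {m k : ℕ}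
    (A : SymHat V →ₗ[ℝ] EuclideanSpace ℝ (Fin m)) (b : EuclideanSpace ℝ (Fin m))
    (L : EuclideanSpace ℝ (Fin k) →ₗ[ℝ] SymHat V)
    (Chat : Set (SymHat V)) (hChat : Chat = sdpFeasible A b)
    (C : Set (EuclideanSpace ℝ (Fin k))) (hC : C = LinearMap.adjoint L '' Chat)
    (hTDI : IsTDIThrough A b L) (hb : IntVec b)
    (hpd : ∃ X ∈ Chat, X.toMatrix.PosDef)
    (hbox : ∀ x ∈ C, ∀ i, x i ∈ Set.Icc (0 : ℝ) 1) (hcpt : IsCompact C)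
    (hemb : IsRankOneEmbedding L Chat C)
    (w : EuclideanSpace ℝ (Fin k)) (hw : IntVec w) :
    ∃ v : ℝ,
      IsGreatest ((fun x => inner ℝ w x) '' integerHull C) v ∧
      (supValue (L w) (isdpFeasible A b) = v ∧
        supValue (L w) (sdpFeasible A b) = v ∧
        infValue b (sddFeasible A (L w)) = v ∧
        infValue b (isddFeasible A (L w)) = v) ∧
      (∃ X ∈ isdpFeasible A b, inner ℝ (L w) X = v) ∧
      (∃ X ∈ sdpFeasible A b, inner ℝ (L w) X = v) ∧
      (∃ y ∈ sddFeasible A (L w), inner ℝ b y = v) ∧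
      (∃ y ∈ isddFeasible A (L w), inner ℝ b y = v) := by
  subst hChat hC
  have hsupp : HasIntegralSupport (LinearMap.adjoint L '' sdpFeasible A b) := fun u hu => by
    obtain ⟨y, hy, hmax⟩ := hTDI.exists_mem_isddFeasible hpd hcpt hu
    obtain ⟨z, hz⟩ := hb.exists_inner_eq hy.1
    exact ⟨z, hz ▸ hmax⟩
  obtain ⟨y, hy, hmax⟩ := hTDI.exists_mem_isddFeasible hpd hcpt hw
  obtain ⟨x, hxC, hx, hxmax⟩ := hsupp.exists_intVec_isMaxOn hcpt hw
  have hxy : inner ℝ w x = inner ℝ b y := by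
    refine le_antisymm (hmax.2 ⟨x, hxC, rfl⟩) ?_
    obtain ⟨x', hx', hxy'⟩ := hmax.1
    exact hxy' ▸ hxmax x' hx'
  -- An integral point of the unit box is a 0-1 point.
  obtain ⟨U, hU, hUx⟩ := hemb x hxC fun i => by
    obtain ⟨z, hz⟩ := hx i
    have h := hbox x hxC i
    rw [hz] at h ⊢
    have h₀ : 0 ≤ z := by exact_mod_cast h.1
    have h₁ : z ≤ 1 := by exact_mod_cast h.2
    rcases (by omega : z = 0 ∨ z = 1) with rfl | rfl <;> simp
  have hUv : inner ℝ (L w) (embed U) = inner ℝ b y := by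
    rw [← LinearMap.adjoint_inner_right, hUx, hxy]
  have hUI : embed U ∈ isdpFeasible A b := ⟨primalIntegral_embed U, hU.2⟩
  have hprimal : ∀ X ∈ sdpFeasible A b, inner ℝ (L w) X ≤ inner ℝ b y := fun X hX =>
    inner_le_inner_of_feasible hX (isddFeasible_subset hy)
  have hdual : ∀ z ∈ sddFeasible A (L w), inner ℝ b y ≤ inner ℝ b z := fun z hz =>
    hUv ▸ inner_le_inner_of_feasible hU hz
  have hhull : integerHull (LinearMap.adjoint L '' sdpFeasible A b) ⊆
      {p | inner ℝ w p ≤ inner ℝ b y} :=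
    convexHull_min (fun p hp => hmax.2 ⟨p, hp.1, rfl⟩)
      (convex_halfSpace_le (innerₗ (EuclideanSpace ℝ (Fin k)) w).isLinear _)
  refine ⟨inner ℝ b y, ⟨⟨x, subset_convexHull ℝ _ ⟨hxC, hx⟩, hxy⟩, ?_⟩, ⟨?_, ?_, ?_, ?_⟩,
    ⟨_, hUI, hUv⟩, ⟨_, hU, hUv⟩, ⟨y, isddFeasible_subset hy, rfl⟩, ⟨y, hy, rfl⟩⟩
  · rintro _ ⟨p, hp, rfl⟩
    exact hhull hp
  · exact supValue_eq (fun X hX => hprimal X (isdpFeasible_subset hX)) ⟨_, hUI, hUv⟩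
  · exact supValue_eq hprimal ⟨_, hU, hUv⟩
  · exact infValue_eq hdual ⟨y, isddFeasible_subset hy, rfl⟩
  · exact infValue_eq (fun z hz => hdual z (isddFeasible_subset hz)) ⟨y, hy, rfl⟩
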